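/- Let $(\Omega,\mathcal F,\mathbb P)$ be a probability space carrying a standard Brownian motion $B$, a Poisson process $N$ with intensity $\lambda>0$, and i.i.d. nonnegative claims $Y_1,Y_2,\dots$ independent of $N$. Let $c,M,a,\hat b,\hat\sigma>0$ be constants. For $r\in\mathbb R$ let $(r_t)_{t\ge0}$ be the Ornstein–Uhlenbeck process $$dr_t=a(\hat b-r_t)\,dt+\hat\sigma\,dB_t,\qquad r_0=r .$$ For $x\ge 0$ let $X_t=x+ct-\sum_{k=1}^{N(t)}Y_k$, and let $(\mathcal F_t)$ be the filtration generated by $(B,X)$. An admissible strategy is a process $L_t=\int_0^t l_s\,ds$ with $l_s\in[0,M]$ that is $(\mathcal F_t)$-predictable, nondecreasing and càdlàg and is such that the surplus $X^L_t=X_t-L_t$ is nonnegative for all $t<\tau^L$, where $\tau^L=\inf\{t\ge0: X^L_t<0\}$ (with $\inf\emptyset=\infty$) is the ruin time. Let $$V(r,x)=\sup_{L\text{ admissible}}\mathbb E\left[\int_0^{\tau^L}e^{-\int_0^s r_u\,du}\,l_s\,ds\right].$$ Put $b=\hat b-\dfrac{\hat\sigma^2}{2a^2}$ and assume $b>0$.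 Then for all $r\in\mathbb R$ and $x\ge0$, $$V(r,x)\le \frac{M}{b}\,e^{-\min\left\{\frac{r-b}{a},\,0\right\}}.$$ In particular $V$ is finite, and it is bounded on $[r_0,\infty)\times[0,\infty)$ for every $r_0\in\mathbb R$. -/

import Mathlib

open MeasureTheory ProbabilityTheory Filter Topology
open scoped NNReal ENNReal

noncomputable section

namespace VasicekDividend

/-- `N` is a Poisson process with intensity `lam`: it starts at `0`, its paths are nondecreasing and
right-continuous, its increments are independent, and `N (s + t) - N s` is Poisson distributed with
parameter `lam * t`. (Increments are taken in `ℝ`.) -/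
structure IsPoissonProcess {Ω : Type*} [MeasurableSpace Ω] (N : ℝ≥0 → Ω → ℕ) (lam : ℝ≥0)
    (P : Measure Ω) : Prop where
  measurable : ∀ t, Measurable (N t)
  start : ∀ᵐ ω ∂P, N 0 ω = 0
  mono : ∀ᵐ ω ∂P, Monotone (fun t => N t ω)
  rightCont : ∀ᵐ ω ∂P, ∀ t, ContinuousWithinAt (fun s => N s ω) (Set.Ici t) t
  indepIncrements : HasIndepIncrements (fun t ω => (N t ω : ℝ)) P
  incrementLaw : ∀ s t, HasLaw (fun ω => (N (s + t) ω : ℝ) - (N s ω : ℝ))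
    ((poissonMeasure (lam * t)).map (Nat.cast : ℕ → ℝ)) P

/-- `ρ` is a solution, with initial value `r`, of the Vasicek (Ornstein-Uhlenbeck) equation
`dρ_t = a (bhat - ρ_t) dt + sigma dB_t`. The noise is additive, so the integrated equation
`ρ_t = r + ∫_0^t a (bhat - ρ_u) du + sigma B_t` involves no further stochastic integral. -/
def IsVasicekSolution {Ω : Type*} [MeasurableSpace Ω] (P : Measure Ω) (B : ℝ≥0 → Ω → ℝ)
    (a bhat sigma r : ℝ) (ρ : ℝ≥0 → Ω → ℝ) : Prop :=
  ∀ᵐ ω ∂P, Continuous (fun t => ρ t ω) ∧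
    ∀ t : ℝ≥0, ρ t ω = r + (∫ u in (0 : ℝ)..t, a * (bhat - ρ u.toNNReal ω)) + sigma * B t ω

/-- The data of the dividend problem with Vasicek interest rate on a probability space `(Ω, P)`. -/
structure Model (Ω : Type*) [MeasurableSpace Ω] (P : Measure Ω) where
  /-- premium rate -/
  c : ℝ
  c_pos : 0 < c
  /-- maximal dividend rate -/
  M : ℝ
  M_pos : 0 < M
  /-- claim intensity -/
  lam : ℝ≥0
  lam_pos : 0 < lam
  /-- distribution of the claim sizes -/
  G : Measure ℝ
  G_nonneg : ∀ᵐ y ∂G, 0 ≤ y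
  /-- claim number process -/
  N : ℝ≥0 → Ω → ℕ
  poisson : IsPoissonProcess N lam P
  /-- claim sizes; `Y k` is the size of the `(k + 1)`-st claim -/
  Y : ℕ → Ω → ℝ
  Y_measurable : ∀ k, Measurable (Y k)
  Y_indep : iIndepFun Y P
  Y_law : ∀ k, HasLaw (Y k) G P
  N_indep_Y : IndepFun (fun ω t => N t ω) (fun ω k => Y k ω) P
  /-- the standard Brownian motion driving the interest rate -/
  B : ℝ≥0 → Ω → ℝ
  B_measurable : ∀ t, Measurable (B t)
  brownian : IsBrownianReal B P
  /-- speed of mean reversion -/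
  a : ℝ
  a_pos : 0 < a
  /-- long-term mean of the interest rate -/
  bhat : ℝ
  bhat_pos : 0 < bhat
  /-- volatility of the interest rate -/
  sigma : ℝ
  sigma_pos : 0 < sigma
  /-- `rate r` is the interest rate process with initial value `r` -/
  rate : ℝ → ℝ≥0 → Ω → ℝ
  rate_sde : ∀ r, IsVasicekSolution P B a bhat sigma r (rate r)

variable {Ω : Type*} [mΩ : MeasurableSpace Ω] {P : Measure Ω}

namespace Model

/-- The reserve process without dividends, `X_t = x + c t - ∑_{k = 1}^{N(t)} Y_k`. -/
def reserve (m : Model Ω P) (x : ℝ) (t : ℝ≥0) (ω : Ω) : ℝ :=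
  x + m.c * t - ∑ k ∈ Finset.range (m.N t ω), m.Y k ω

theorem measurable_reserve (m : Model Ω P) (x : ℝ) (t : ℝ≥0) : Measurable (m.reserve x t) := by
  have h : Measurable (fun p : ℕ × Ω => ∑ k ∈ Finset.range p.1, m.Y k p.2) :=
    measurable_from_prod_countable_right fun n =>
      Finset.measurable_fun_sum (Finset.range n) fun k _ => m.Y_measurable k
  exact measurable_const.sub (h.comp ((m.poisson.measurable t).prodMk measurable_id))

/-- The filtration generated by the pair `(B, X)`. -/
def filtration (m : Model Ω P) (x : ℝ) : Filtration ℝ≥0 mΩ :=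
  Filtration.natural (fun t ω => (m.B t ω, m.reserve x t ω)) fun t =>
    ((m.B_measurable t).prodMk (m.measurable_reserve x t)).stronglyMeasurable

end Model

/-- The cumulated dividends `L_t = ∫_0^t l_s ds` of the dividend rate process `l`. -/
def cumulated (l : ℝ≥0 → Ω → ℝ) (t : ℝ≥0) (ω : Ω) : ℝ :=
  ∫ s in (0 : ℝ)..t, l s.toNNReal ω

namespace Model

/-- The surplus process `X_t^L = X_t - L_t` when dividends are paid at rate `l`. -/
def surplus (m : Model Ω P) (x : ℝ) (l : ℝ≥0 → Ω → ℝ) (t : ℝ≥0) (ω : Ω) : ℝ :=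
  m.reserve x t ω - cumulated l t ω

/-- The ruin time `inf {t ≥ 0 | X_t^L < 0}`, which is `⊤` if there is no ruin. -/
def ruinTime (m : Model Ω P) (x : ℝ) (l : ℝ≥0 → Ω → ℝ) : Ω → WithTop ℝ≥0 :=
  hittingAfter (m.surplus x l) (Set.Iio 0) 0

/-- The strategy of paying dividends at the rate `l` is admissible for the initial surplus `x`:
the rate takes values in `[0, M]`, the cumulated dividends are predictable, nondecreasing and
cadlag, and the surplus is nonnegative up to the time of ruin. -/
structure Admissible (m : Model Ω P) (x : ℝ) (l : ℝ≥0 → Ω → ℝ) : Prop where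
  measurable : Measurable (Function.uncurry l)
  mem_Icc : ∀ t ω, l t ω ∈ Set.Icc 0 m.M
  predictable : IsStronglyPredictable (m.filtration x) (cumulated l)
  mono : ∀ ω, Monotone (fun t => cumulated l t ω)
  cadlag : ∀ ω t, ContinuousWithinAt (fun s => cumulated l s ω) (Set.Ici t) t ∧
    ∃ y, Tendsto (fun s => cumulated l s ω) (𝓝[<] t) (𝓝 y)
  nonneg : ∀ (ω : Ω) (t : ℝ≥0), (t : WithTop ℝ≥0) < m.ruinTime x l ω → 0 ≤ m.surplus x l t ω

/-- The integrated interest rate `U_s^r = ∫_0^s r_u du` with initial rate `r`. -/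
def integratedRate (m : Model Ω P) (r s : ℝ) (ω : Ω) : ℝ :=
  ∫ u in (0 : ℝ)..s, m.rate r u.toNNReal ω

/-- The return function `V^L(r, x) = E[∫_0^{τ^L} exp(-U_s^r) l_s ds]` of the strategy with dividend
rate `l`. The integrand is nonnegative, and the value lies in `[0, ∞]`. -/
def returnFunction (m : Model Ω P) (l : ℝ≥0 → Ω → ℝ) (r x : ℝ) : ℝ≥0∞ :=
  ∫⁻ ω, (∫⁻ s in {s : ℝ | 0 ≤ s ∧ ((s.toNNReal : ℝ≥0) : WithTop ℝ≥0) < m.ruinTime x l ω},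
    ENNReal.ofReal (Real.exp (-m.integratedRate r s ω) * l s.toNNReal ω)) ∂P

/-- The value function: the supremum of the return function over all admissible strategies. It is
`[0, ∞]`-valued a priori. -/
def value (m : Model Ω P) (r x : ℝ) : ℝ≥0∞ :=
  ⨆ (l : ℝ≥0 → Ω → ℝ) (_ : m.Admissible x l), m.returnFunction l r x

end Model

end VasicekDividend

end

/-!
With `D t = (1 - e^{-at}) / a`, variation of constants turns the Vasicek equation into
`∫_0^s r_u du = β s + (r - β) D s + σ ∫_0^s D (s - u) dB_u`. The last integral exists path by path,
since `D` is smooth, and its Riemann–Stieltjes sums are Gaussian with explicit exponential moments.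
Fatou's lemma therefore bounds `E[exp (-∫_0^s r_u du)]` by the Vasicek bond price
`exp (-b s - (r - b) D s - σ² (D s)² / (4a))`. As `0 ≤ D s ≤ 1/a`, this is at most
`e^{-b s} e^{-min ((r - b) / a) 0}`, and it remains to integrate in `s` and to use `l ≤ M`.
-/

namespace VasicekDividend

section StieltjesIntegral

theorem sum_range_succ_mul_sub {R : Type*} [Ring R] (g w : ℕ → R) (n : ℕ) :
    ∑ i ∈ Finset.range n, g (i + 1) * (w (i + 1) - w i)
      = g n * w n - g 0 * w 0 - ∑ i ∈ Finset.range n, (g (i + 1) - g i) * w i := by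
  rw [← Finset.sum_range_sub (fun i => g i * w i), ← Finset.sum_sub_distrib]
  exact Finset.sum_congr rfl fun i _ => by noncomm_ring

theorem abs_sum_mul_integral_sub_integral_mul_le {φ f : ℝ → ℝ} {t τ : ℕ → ℝ} {n : ℕ} {ε : ℝ}
    (ht : Monotone t) (hf : IntervalIntegrable f volume (t 0) (t n))
    (hφf : IntervalIntegrable (fun u => φ u * f u) volume (t 0) (t n))
    (hε : ∀ i < n, ∀ u ∈ Set.Icc (t i) (t (i + 1)), |φ (τ i) - φ u| ≤ ε) :
    |∑ i ∈ Finset.range n, φ (τ i) * (∫ u in (t i)..(t (i + 1)), f u)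
        - ∫ u in (t 0)..(t n), φ u * f u| ≤ ε * ∫ u in (t 0)..(t n), |f u| := by
  have hsub : ∀ i < n, Set.uIcc (t i) (t (i + 1)) ⊆ Set.uIcc (t 0) (t n) := fun i hi => by
    rw [Set.uIcc_of_le (ht i.le_succ), Set.uIcc_of_le (ht n.zero_le)]
    exact Set.Icc_subset_Icc (ht i.zero_le) (ht hi)
  have hf' : ∀ i < n, IntervalIntegrable f volume (t i) (t (i + 1)) :=
    fun i hi => hf.mono_set (hsub i hi)
  have hφf' : ∀ i < n, IntervalIntegrable (fun u => φ u * f u) volume (t i) (t (i + 1)) :=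
    fun i hi => hφf.mono_set (hsub i hi)
  rw [← intervalIntegral.sum_integral_adjacent_intervals hφf',
    ← intervalIntegral.sum_integral_adjacent_intervals fun i hi => (hf' i hi).abs,
    ← Finset.sum_sub_distrib, Finset.mul_sum]
  refine (Finset.abs_sum_le_sum_abs _ _).trans (Finset.sum_le_sum fun i hi => ?_)
  have hin := Finset.mem_range.1 hi
  rw [← intervalIntegral.integral_const_mul, ← intervalIntegral.integral_const_mul,
    ← intervalIntegral.integral_sub ((hf' i hin).const_mul _) (hφf' i hin)]
  refine intervalIntegral.norm_integral_le_of_norm_le (f := fun u => φ (τ i) * f u - φ u * f u)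
    (ht i.le_succ) (ae_of_all _ fun u hu => ?_) ((hf' i hin).abs.const_mul ε)
  rw [← sub_mul, Real.norm_eq_abs, abs_mul]
  exact mul_le_mul_of_nonneg_right (hε i hin u (Set.Ioc_subset_Icc_self hu)) (abs_nonneg _)

/-- The `i`-th point of the partition of `[0, s]` into `n` intervals of equal length, along which
the Riemann sums below are taken. -/
noncomputable def uniformPartition (s : ℝ) (n i : ℕ) : ℝ := i * (s / n)

theorem uniformPartition_zero (s : ℝ) (n : ℕ) : uniformPartition s n 0 = 0 := by
  simp [uniformPartition]

theorem uniformPartition_self (s : ℝ) {n : ℕ} (hn : n ≠ 0) : uniformPartition s n n = s :=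
  mul_div_cancel₀ s (Nat.cast_ne_zero.2 hn)

theorem uniformPartition_succ (s : ℝ) (n i : ℕ) :
    uniformPartition s n (i + 1) = uniformPartition s n i + s / n := by
  simp only [uniformPartition]
  push_cast
  ring

theorem monotone_uniformPartition {s : ℝ} (hs : 0 ≤ s) (n : ℕ) :
    Monotone (uniformPartition s n) := fun i j hij => by
  unfold uniformPartition
  gcongr

theorem uniformPartition_mem_Icc {s : ℝ} (hs : 0 ≤ s) {n i : ℕ} (hi : i ≤ n) :
    uniformPartition s n i ∈ Set.Icc 0 s := by
  refine ⟨by unfold uniformPartition; positivity, ?_⟩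
  rcases eq_or_ne n 0 with rfl | hn
  · simpa [uniformPartition] using hs
  · exact (monotone_uniformPartition hs n hi).trans (uniformPartition_self s hn).le

theorem tendsto_sum_mul_integral {φ f : ℝ → ℝ} {s : ℝ} (hs : 0 ≤ s)
    (hφ : ContinuousOn φ (Set.Icc 0 s)) (hf : IntervalIntegrable f volume 0 s) {τ : ℕ → ℕ → ℝ}
    (hτ : ∀ n i, τ n i ∈ Set.Icc (uniformPartition s n i) (uniformPartition s n (i + 1))) :
    Tendsto (fun n => ∑ i ∈ Finset.range n, φ (τ n i)
        * ∫ u in (uniformPartition s n i)..(uniformPartition s n (i + 1)), f u) atTop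
      (𝓝 (∫ u in (0 : ℝ)..s, φ u * f u)) := by
  have hI : 0 ≤ ∫ u in (0 : ℝ)..s, |f u| :=
    intervalIntegral.integral_nonneg hs fun _ _ => abs_nonneg _
  have huc := Metric.uniformContinuousOn_iff_le.1
    (isCompact_Icc.uniformContinuousOn_of_continuous hφ)
  refine Metric.tendsto_nhds.2 fun ε hε => ?_
  obtain ⟨δ, hδ, hφδ⟩ := huc (ε / ((∫ u in (0 : ℝ)..s, |f u|) + 1)) (by positivity)
  filter_upwards [eventually_ne_atTop 0,
    (tendsto_const_div_atTop_nhds_zero_nat s).eventually_le_const hδ] with n hn hmesh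
  have h0 := uniformPartition_zero s n
  have hlast := uniformPartition_self s hn
  have hφf : IntervalIntegrable (fun u => φ u * f u) volume 0 s :=
    hf.continuousOn_mul (by rwa [Set.uIcc_of_le hs])
  have hosc : ∀ i < n, ∀ u ∈ Set.Icc (uniformPartition s n i) (uniformPartition s n (i + 1)),
      |φ (τ n i) - φ u| ≤ ε / ((∫ u in (0 : ℝ)..s, |f u|) + 1) := fun i hi u hu => by
    have hIcc : Set.Icc (uniformPartition s n i) (uniformPartition s n (i + 1)) ⊆ Set.Icc 0 s :=
      Set.Icc_subset_Icc (uniformPartition_mem_Icc hs hi.le).1 (uniformPartition_mem_Icc hs hi).2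
    refine hφδ _ (hIcc (hτ n i)) _ (hIcc hu) ((Real.dist_le_of_mem_Icc (hτ n i) hu).trans ?_)
    rwa [uniformPartition_succ, add_sub_cancel_left]
  have herr := abs_sum_mul_integral_sub_integral_mul_le (f := f) (monotone_uniformPartition hs n)
    (by rwa [h0, hlast]) (by rwa [h0, hlast]) hosc
  rw [h0, hlast] at herr
  refine herr.trans_lt ?_
  rw [div_mul_eq_mul_div, div_lt_iff₀ (by positivity)]
  exact mul_lt_mul_of_pos_left (lt_add_one _) hε

theorem tendsto_sum_mul_sub_uniformPartition {f : ℝ → ℝ} {s : ℝ} (hs : 0 ≤ s)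
    (hf : ContinuousOn f (Set.Icc 0 s)) :
    Tendsto (fun n => ∑ i ∈ Finset.range n, f (uniformPartition s n (i + 1))
        * (uniformPartition s n (i + 1) - uniformPartition s n i)) atTop
      (𝓝 (∫ u in (0 : ℝ)..s, f u)) := by
  simpa only [mul_one, intervalIntegral.integral_const, smul_eq_mul] using
    tendsto_sum_mul_integral hs hf (intervalIntegrable_const (c := (1 : ℝ)))
      fun n i => Set.right_mem_Icc.2 (monotone_uniformPartition hs n i.le_succ)

/-- The Riemann–Stieltjes integral `∫_0^s g dw`, for `g` continuously differentiable and `w` merely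
continuous. It is defined through integration by parts, so that it applies to each path `w` of a
Brownian motion. -/
noncomputable def stieltjesIntegral (g w : ℝ → ℝ) (s : ℝ) : ℝ :=
  g s * w s - g 0 * w 0 - ∫ u in (0 : ℝ)..s, w u * deriv g u

theorem tendsto_sum_stieltjesIntegral {g w : ℝ → ℝ} {s : ℝ} (hs : 0 ≤ s) (hg : ContDiff ℝ 1 g)
    (hw : ContinuousOn w (Set.Icc 0 s)) :
    Tendsto (fun n => ∑ i ∈ Finset.range n, g (uniformPartition s n (i + 1))
        * (w (uniformPartition s n (i + 1)) - w (uniformPartition s n i))) atTop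
      (𝓝 (stieltjesIntegral g w s)) := by
  have hg' : Continuous (deriv g) := hg.continuous_deriv_one
  have hlim := (tendsto_sum_mul_integral hs hw (hg'.intervalIntegrable 0 s)
    fun n i => Set.left_mem_Icc.2 (monotone_uniformPartition hs n i.le_succ)).const_sub
    (g s * w s - g 0 * w 0)
  refine hlim.congr' ((eventually_ne_atTop 0).mono fun n hn => ?_)
  beta_reduce
  rw [sum_range_succ_mul_sub (fun i => g (uniformPartition s n i))
    fun i => w (uniformPartition s n i), uniformPartition_zero, uniformPartition_self s hn]
  congr 1
  refine Finset.sum_congr rfl fun i _ => ?_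
  rw [intervalIntegral.integral_deriv_eq_sub (fun u _ => (hg.differentiable one_ne_zero) u)
    (hg'.intervalIntegrable _ _), mul_comm]

end StieltjesIntegral

section BrownianMotion

variable {Ω : Type*} [MeasurableSpace Ω] {P : Measure Ω} {B : ℝ≥0 → Ω → ℝ}

theorem lintegral_exp_sum_mul_increment (hB : IsPreBrownianReal B P) {t : ℕ → ℝ≥0}
    (ht : Monotone t) (k : ℕ → ℝ) (n : ℕ) :
    ∫⁻ ω, ENNReal.ofReal (Real.exp (∑ i ∈ Finset.range n,
        k i * (B (t (i + 1)) ω - B (t i) ω))) ∂P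
      = ENNReal.ofReal (Real.exp (∑ i ∈ Finset.range n,
        k i ^ 2 * ((t (i + 1) : ℝ) - t i) / 2)) := by
  have : IsProbabilityMeasure P := hB.isGaussianProcess.isProbabilityMeasure
  let Z : ℕ → Ω → ℝ := fun i ω => k i * (B (t (i + 1)) - B (t i)) ω
  have hindep : iIndepFun Z P :=
    (hB.hasIndepIncrements.nat ht).comp (fun i x => k i * x) fun i => by fun_prop
  have hmeas : ∀ i, AEMeasurable (Z i) P := fun i =>
    ((hB.aemeasurable _).sub (hB.aemeasurable _)).const_mul _
  have hterm : ∀ i, mgf (Z i) P 1 = Real.exp (k i ^ 2 * ((t (i + 1) : ℝ) - t i) / 2) := fun i => by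
    have hvar : ((nndist (t (i + 1)).1 (t i).1 : ℝ≥0) : ℝ) = (t (i + 1) : ℝ) - t i := by
      rw [coe_nndist, Real.dist_eq]
      exact abs_of_nonneg (sub_nonneg.2 (NNReal.coe_le_coe.2 (ht i.le_succ)))
    rw [mgf_const_mul, mgf_gaussianReal (hB.hasLaw_sub _ _).map_eq, hvar]
    ring_nf
  have hmgf : mgf (∑ i ∈ Finset.range n, Z i) P 1
      = Real.exp (∑ i ∈ Finset.range n, k i ^ 2 * ((t (i + 1) : ℝ) - t i) / 2) := by
    rw [hindep.mgf_sum₀ hmeas, Real.exp_sum]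
    exact Finset.prod_congr rfl fun i _ => hterm i
  have hint : Integrable (fun ω => Real.exp (1 * (∑ i ∈ Finset.range n, Z i) ω)) P :=
    mgf_pos_iff.1 (hmgf ▸ Real.exp_pos _)
  rw [← hmgf, mgf,
    ofReal_integral_eq_lintegral_ofReal hint (ae_of_all _ fun _ => (Real.exp_pos _).le)]
  simp [Z]

theorem lintegral_exp_mul_stieltjesIntegral_le (hB : IsBrownianReal B P) {g : ℝ → ℝ}
    (hg : ContDiff ℝ 1 g) {s : ℝ} (hs : 0 ≤ s) (θ : ℝ) :
    ∫⁻ ω, ENNReal.ofReal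
        (Real.exp (θ * stieltjesIntegral g (fun u => B u.toNNReal ω) s)) ∂P
      ≤ ENNReal.ofReal (Real.exp (θ ^ 2 / 2 * ∫ u in (0 : ℝ)..s, g u ^ 2)) := by
  let t : ℕ → ℕ → ℝ := uniformPartition s
  let S : ℕ → Ω → ℝ := fun n ω => ∑ i ∈ Finset.range n,
    θ * g (t n (i + 1)) * (B (t n (i + 1)).toNNReal ω - B (t n i).toNNReal ω)
  let v : ℕ → ℝ := fun n =>
    ∑ i ∈ Finset.range n, (θ * g (t n (i + 1))) ^ 2 * (t n (i + 1) - t n i) / 2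
  have hexp : Continuous fun y => ENNReal.ofReal (Real.exp y) :=
    ENNReal.continuous_ofReal.comp Real.continuous_exp
  have hS : ∀ᵐ ω ∂P, Tendsto (fun n => S n ω) atTop
      (𝓝 (θ * stieltjesIntegral g (fun u => B u.toNNReal ω) s)) := by
    filter_upwards [hB.cont] with ω hω
    have hpath := (hω.comp continuous_real_toNNReal).continuousOn (s := Set.Icc 0 s)
    refine ((tendsto_sum_stieltjesIntegral hs hg hpath).const_mul θ).congr fun n => ?_
    simp only [S, t, Finset.mul_sum, mul_assoc, Function.comp_apply]
  have hv : Tendsto v atTop (𝓝 (θ ^ 2 / 2 * ∫ u in (0 : ℝ)..s, g u ^ 2)) := by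
    have hsq := tendsto_sum_mul_sub_uniformPartition hs (hg.continuous.pow 2).continuousOn
    refine (hsq.const_mul (θ ^ 2 / 2)).congr fun n => ?_
    rw [Finset.mul_sum]
    exact Finset.sum_congr rfl fun i _ => by simp only [t, Pi.pow_apply]; ring
  have hmoment : ∀ n, ∫⁻ ω, ENNReal.ofReal (Real.exp (S n ω)) ∂P
      = ENNReal.ofReal (Real.exp (v n)) := fun n => by
    have ht : Monotone (t n) := monotone_uniformPartition hs n
    have ht0 : ∀ i, 0 ≤ t n i := fun i => (uniformPartition_zero s n).ge.trans (ht i.zero_le)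
    simpa only [Real.coe_toNNReal _ (ht0 _)] using
      lintegral_exp_sum_mul_increment hB.toIsPreBrownianReal
        (fun i j hij => Real.toNNReal_mono (ht hij)) (fun i => θ * g (t n (i + 1))) n
  calc _ = ∫⁻ ω, liminf (fun n => ENNReal.ofReal (Real.exp (S n ω))) atTop ∂P :=
        lintegral_congr_ae <| hS.mono fun ω hω => ((hexp.tendsto _).comp hω).liminf_eq.symm
    _ ≤ liminf (fun n => ∫⁻ ω, ENNReal.ofReal (Real.exp (S n ω)) ∂P) atTop := by
        refine lintegral_liminf_le' fun n => hexp.measurable.comp_aemeasurable ?_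
        have hBm := hB.toIsPreBrownianReal.aemeasurable
        fun_prop
    _ = _ := by
        simp only [hmoment]
        exact ((hexp.tendsto _).comp hv).liminf_eq

end BrownianMotion

section Measurability

variable {Ω : Type*} [MeasurableSpace Ω] {P : Measure Ω}

theorem exists_measurable_uncurry_of_ae_continuous {ι E : Type*} [TopologicalSpace ι]
    [TopologicalSpace.MetrizableSpace ι] [SecondCountableTopology ι] [MeasurableSpace ι]
    [OpensMeasurableSpace ι] [TopologicalSpace E] [TopologicalSpace.PseudoMetrizableSpace E]
    [MeasurableSpace E] [BorelSpace E] [Zero E] {X : ι → Ω → E} (hX : ∀ t, Measurable (X t))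
    (hcont : ∀ᵐ ω ∂P, Continuous fun t => X t ω) :
    ∃ Y : ι → Ω → E, Measurable (Function.uncurry Y) ∧ ∀ᵐ ω ∂P, ∀ t, Y t ω = X t ω := by
  obtain ⟨A, hA, hAm, hAcont⟩ := hcont.exists_measurable_mem
  refine ⟨fun t => A.indicator (X t), measurable_uncurry_of_continuous_of_measurable (fun ω => ?_)
    fun t => (hX t).indicator hAm, ?_⟩
  · by_cases hω : ω ∈ A
    · simpa only [Set.indicator_of_mem hω] using hAcont ω hω
    · simpa only [Set.indicator_of_notMem hω] using continuous_const
  · filter_upwards [hA] with ω hω t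
    exact Set.indicator_of_mem hω _

theorem stronglyMeasurable_intervalIntegral {E : Type*} [NormedAddCommGroup E] [NormedSpace ℝ E]
    {f : Ω × ℝ → E} (hf : StronglyMeasurable f) :
    StronglyMeasurable fun p : Ω × ℝ => ∫ u in (0 : ℝ)..p.2, f (p.1, u) := by
  -- The substitution `u = s v` makes the domain of integration independent of `s`.
  have hscale : (fun p : Ω × ℝ => ∫ u in (0 : ℝ)..p.2, f (p.1, u))
      = fun p => p.2 • ∫ v in Set.Ioc (0 : ℝ) 1, f (p.1, p.2 * v) := by
    funext p
    rw [← intervalIntegral.integral_of_le zero_le_one,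
      intervalIntegral.smul_integral_comp_mul_left (fun u => f (p.1, u)), mul_zero, mul_one]
  have hcomp : StronglyMeasurable fun q : (Ω × ℝ) × ℝ => f (q.1.1, q.1.2 * q.2) :=
    hf.comp_measurable (by fun_prop)
  rw [hscale]
  exact measurable_snd.stronglyMeasurable.smul hcomp.integral_prod_right'

end Measurability

section BondDuration

/-- The coefficient `(1 - e^{-at}) / a = ∫_0^t e^{-au} du` of the initial rate in the logarithm of
the Vasicek price of a zero-coupon bond with maturity `t`. -/
noncomputable def bondDuration (a t : ℝ) : ℝ := (1 - Real.exp (-(a * t))) / a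

variable {a : ℝ}

theorem bondDuration_zero (a : ℝ) : bondDuration a 0 = 0 := by simp [bondDuration]

theorem exp_neg_mul_eq_one_sub_bondDuration (ha : a ≠ 0) (t : ℝ) :
    Real.exp (-(a * t)) = 1 - a * bondDuration a t := by
  rw [bondDuration, mul_div_cancel₀ _ ha, sub_sub_cancel]

theorem bondDuration_mem_Icc (ha : 0 < a) {t : ℝ} (ht : 0 ≤ t) :
    bondDuration a t ∈ Set.Icc 0 (1 / a) := by
  have hle : Real.exp (-(a * t)) ≤ 1 := Real.exp_le_one_iff.2 (neg_nonpos.2 (by positivity))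
  exact ⟨div_nonneg (sub_nonneg.2 hle) ha.le,
    div_le_div_of_nonneg_right (sub_le_self 1 (Real.exp_pos _).le) ha.le⟩

theorem contDiff_bondDuration (a : ℝ) : ContDiff ℝ 1 (bondDuration a) := by
  unfold bondDuration
  fun_prop

theorem hasDerivAt_bondDuration (ha : a ≠ 0) (t : ℝ) :
    HasDerivAt (bondDuration a) (Real.exp (-(a * t))) t := by
  have hexp : HasDerivAt (fun t => Real.exp (-(a * t))) (Real.exp (-(a * t)) * -a) t := by
    simpa using ((hasDerivAt_id t).const_mul a).neg.exp
  refine ((hexp.const_sub 1).div_const a).congr_deriv ?_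
  field_simp

theorem hasDerivAt_bondDuration_const_sub (ha : a ≠ 0) (s u : ℝ) :
    HasDerivAt (fun u => bondDuration a (s - u)) (-Real.exp (-(a * (s - u)))) u :=
  (hasDerivAt_bondDuration ha (s - u)).comp_const_sub s u

theorem integral_exp_neg_mul_const_sub (ha : a ≠ 0) (s : ℝ) :
    ∫ u in (0 : ℝ)..s, Real.exp (-(a * (s - u))) = bondDuration a s := by
  rw [intervalIntegral.integral_eq_sub_of_hasDerivAt
    (fun u _ => by simpa only [neg_neg] using (hasDerivAt_bondDuration_const_sub ha s u).neg)
    (Continuous.intervalIntegrable (by fun_prop) _ _)]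
  simp [bondDuration_zero]

theorem integral_bondDuration_const_sub_sq (ha : a ≠ 0) (s : ℝ) :
    ∫ u in (0 : ℝ)..s, bondDuration a (s - u) ^ 2
      = (s - bondDuration a s) / a ^ 2 - bondDuration a s ^ 2 / (2 * a) := by
  have hderiv : ∀ t ∈ Set.uIcc 0 s, HasDerivAt
      (fun t => (t - bondDuration a t) / a ^ 2 - bondDuration a t ^ 2 / (2 * a))
      (bondDuration a t ^ 2) t := fun t _ => by
    have hD := hasDerivAt_bondDuration ha t
    refine ((((hasDerivAt_id t).sub hD).div_const (a ^ 2)).sub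
      ((hD.pow 2).div_const (2 * a))).congr_deriv ?_
    rw [exp_neg_mul_eq_one_sub_bondDuration ha]
    field_simp
    ring
  rw [intervalIntegral.integral_comp_sub_left (fun t => bondDuration a t ^ 2), sub_self, sub_zero,
    intervalIntegral.integral_eq_sub_of_hasDerivAt hderiv
      (((contDiff_bondDuration a).continuous.pow 2).intervalIntegrable _ _)]
  simp [bondDuration_zero]

theorem stieltjesIntegral_bondDuration_const_sub (ha : a ≠ 0) (w : ℝ → ℝ) (s : ℝ) :
    stieltjesIntegral (fun u => bondDuration a (s - u)) w s
      = (∫ u in (0 : ℝ)..s, Real.exp (-(a * (s - u))) * w u) - bondDuration a s * w 0 := by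
  simp only [stieltjesIntegral, (hasDerivAt_bondDuration_const_sub ha s _).deriv, sub_self,
    bondDuration_zero, mul_comm (w _), neg_mul, intervalIntegral.integral_neg, sub_zero]
  ring

end BondDuration

section IntegratedRate

theorem eq_exp_mul_add_integral_of_hasDerivAt {a s : ℝ} {y f : ℝ → ℝ}
    (hy : ∀ u ∈ Set.uIcc 0 s, HasDerivAt y (f u - a * y u) u)
    (hf : IntervalIntegrable f volume 0 s) :
    y s = Real.exp (-(a * s)) * y 0 + ∫ u in (0 : ℝ)..s, Real.exp (-(a * (s - u))) * f u := by
  have hderiv : ∀ u ∈ Set.uIcc 0 s, HasDerivAt (fun u => Real.exp (-(a * (s - u))) * y u)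
      (Real.exp (-(a * (s - u))) * f u) u := fun u hu => by
    have hexp : HasDerivAt (fun u => Real.exp (-(a * (s - u))))
        (Real.exp (-(a * (s - u))) * a) u := by
      simpa using (((hasDerivAt_id u).const_sub s).const_mul a).neg.exp
    refine (hexp.mul (hy u hu)).congr_deriv ?_
    ring
  rw [intervalIntegral.integral_eq_sub_of_hasDerivAt hderiv
    (hf.continuousOn_mul (Continuous.continuousOn (by fun_prop)))]
  simp

theorem integral_eq_of_vasicek {a β σ r s : ℝ} (ha : a ≠ 0) (hs : 0 ≤ s) {ρ w : ℝ → ℝ}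
    (hρ : Continuous ρ) (hw : IntervalIntegrable w volume 0 s)
    (h : ∀ t ∈ Set.Icc 0 s, ρ t = r + (∫ u in (0 : ℝ)..t, a * (β - ρ u)) + σ * w t) :
    ∫ u in (0 : ℝ)..s, ρ u = β * s + (r - β) * bondDuration a s
      + σ * ∫ u in (0 : ℝ)..s, Real.exp (-(a * (s - u))) * w u := by
  let y : ℝ → ℝ := fun t => (∫ u in (0 : ℝ)..t, ρ u) - β * t
  have hdrift : ∀ t, ∫ u in (0 : ℝ)..t, a * (β - ρ u) = -(a * y t) := fun t => by
    rw [intervalIntegral.integral_const_mul, intervalIntegral.integral_sub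
      intervalIntegrable_const (hρ.intervalIntegrable 0 t), intervalIntegral.integral_const]
    simp only [y, smul_eq_mul]
    ring
  have hy : ∀ t ∈ Set.uIcc 0 s, HasDerivAt y ((r - β + σ * w t) - a * y t) t := fun t ht => by
    rw [Set.uIcc_of_le hs] at ht
    refine ((hρ.integral_hasStrictDerivAt 0 t).hasDerivAt.sub
      ((hasDerivAt_id t).const_mul β)).congr_deriv ?_
    rw [h t ht, hdrift]
    ring
  have hsol := eq_exp_mul_add_integral_of_hasDerivAt hy
    (intervalIntegrable_const.add (hw.const_mul σ))
  have hexp : Continuous fun u => Real.exp (-(a * (s - u))) := by fun_prop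
  have hsplit : ∫ u in (0 : ℝ)..s, Real.exp (-(a * (s - u))) * (r - β + σ * w u)
      = (r - β) * bondDuration a s
        + σ * ∫ u in (0 : ℝ)..s, Real.exp (-(a * (s - u))) * w u := by
    simp only [mul_add, mul_left_comm _ σ]
    rw [intervalIntegral.integral_add ((hexp.intervalIntegrable 0 s).mul_const _)
      ((hw.continuousOn_mul hexp.continuousOn).const_mul σ), intervalIntegral.integral_mul_const,
      intervalIntegral.integral_const_mul, integral_exp_neg_mul_const_sub ha, mul_comm (r - β)]
  rw [hsplit] at hsol
  simp only [y, intervalIntegral.integral_same, mul_zero, sub_zero, zero_add] at hsol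
  linarith

variable {Ω : Type*} [MeasurableSpace Ω] {P : Measure Ω} {B ρ : ℝ≥0 → Ω → ℝ} {a β σ r : ℝ}

theorem IsVasicekSolution.ae_integral_eq (hρ : IsVasicekSolution P B a β σ r ρ)
    (hB : IsBrownianReal B P) (ha : a ≠ 0) :
    ∀ᵐ ω ∂P, ∀ s, 0 ≤ s → ∫ u in (0 : ℝ)..s, ρ u.toNNReal ω
      = β * s + (r - β) * bondDuration a s
        + σ * ∫ u in (0 : ℝ)..s, Real.exp (-(a * (s - u))) * B u.toNNReal ω := by
  filter_upwards [hρ, hB.cont] with ω ⟨hcont, hsde⟩ hBcont s hs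
  refine integral_eq_of_vasicek ha hs (hcont.comp continuous_real_toNNReal)
    ((hBcont.comp continuous_real_toNNReal).intervalIntegrable 0 s) fun t ht => ?_
  simpa only [Function.comp_apply, Real.coe_toNNReal t ht.1] using hsde t.toNNReal

theorem IsVasicekSolution.exists_measurable_integral (hρ : IsVasicekSolution P B a β σ r ρ)
    (hB : IsBrownianReal B P) (hBm : ∀ t, Measurable (B t)) (ha : a ≠ 0) :
    ∃ U : Ω × ℝ → ℝ, Measurable U ∧
      ∀ᵐ ω ∂P, ∀ s, 0 ≤ s → ∫ u in (0 : ℝ)..s, ρ u.toNNReal ω = U (ω, s) := by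
  obtain ⟨C, hC, hCB⟩ := exists_measurable_uncurry_of_ae_continuous hBm hB.cont
  have hCpath : Measurable fun p : Ω × ℝ => Real.exp (a * p.2) * C p.2.toNNReal p.1 :=
    Measurable.mul (by fun_prop)
      (hC.comp (f := fun p : Ω × ℝ => (p.2.toNNReal, p.1)) (by fun_prop))
  have hint := (stronglyMeasurable_intervalIntegral hCpath.stronglyMeasurable).measurable
  have hD : Measurable (bondDuration a) := (contDiff_bondDuration a).continuous.measurable
  refine ⟨fun p => β * p.2 + (r - β) * bondDuration a p.2 + σ * (Real.exp (-(a * p.2))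
    * ∫ u in (0 : ℝ)..p.2, Real.exp (a * u) * C u.toNNReal p.1), by fun_prop, ?_⟩
  filter_upwards [hρ.ae_integral_eq hB ha, hCB] with ω hω hCω s hs
  simp only [hω s hs, ← intervalIntegral.integral_const_mul, hCω, ← mul_assoc, ← Real.exp_add]
  ring_nf

end IntegratedRate

section BondPrice

/-- The yield `β - σ² / (2a²)` of the Vasicek zero-coupon bond as the maturity tends to infinity;
it is the constant `b` of the theorem. -/
noncomputable def longRate (a β σ : ℝ) : ℝ := β - σ ^ 2 / (2 * a ^ 2)

/-- The logarithm of the price `E[exp (-∫_0^s r_u du)]` of the zero-coupon bond with maturity `s` in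
the Vasicek model with initial rate `r`. -/
noncomputable def logBondPrice (a β σ r s : ℝ) : ℝ :=
  -(longRate a β σ * s) - (r - longRate a β σ) * bondDuration a s
    - σ ^ 2 / (4 * a) * bondDuration a s ^ 2

variable {a β σ r : ℝ}

theorem logBondPrice_le (ha : 0 < a) {s : ℝ} (hs : 0 ≤ s) :
    logBondPrice a β σ r s ≤ -longRate a β σ * s + -min ((r - longRate a β σ) / a) 0 := by
  obtain ⟨hD0, hD1⟩ := bondDuration_mem_Icc ha hs
  have hmin : min ((r - longRate a β σ) / a) 0 ≤ (r - longRate a β σ) * bondDuration a s := by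
    rcases le_total 0 (r - longRate a β σ) with h | h
    · exact (min_le_right _ _).trans (mul_nonneg h hD0)
    · refine (min_le_left _ _).trans ?_
      rw [div_eq_mul_one_div]
      exact mul_le_mul_of_nonpos_left hD1 h
  have hsq : 0 ≤ σ ^ 2 / (4 * a) * bondDuration a s ^ 2 := by positivity
  unfold logBondPrice
  linarith

theorem lintegral_Ici_exp_neg_mul {b : ℝ} (hb : 0 < b) :
    ∫⁻ s in Set.Ici (0 : ℝ), ENNReal.ofReal (Real.exp (-b * s)) = ENNReal.ofReal (1 / b) := by
  rw [setLIntegral_congr Ioi_ae_eq_Ici.symm, ← ofReal_integral_eq_lintegral_ofReal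
    (integrableOn_exp_mul_Ioi (neg_lt_zero.2 hb) 0) (ae_of_all _ fun _ => (Real.exp_pos _).le),
    integral_exp_mul_Ioi (neg_lt_zero.2 hb)]
  simp

theorem lintegral_Ici_exp_logBondPrice_le (ha : 0 < a) (hb : 0 < longRate a β σ) :
    ∫⁻ s in Set.Ici (0 : ℝ), ENNReal.ofReal (Real.exp (logBondPrice a β σ r s))
      ≤ ENNReal.ofReal (Real.exp (-min ((r - longRate a β σ) / a) 0) / longRate a β σ) := by
  calc _ ≤ ∫⁻ s in Set.Ici (0 : ℝ), ENNReal.ofReal (Real.exp (-longRate a β σ * s))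
        * ENNReal.ofReal (Real.exp (-min ((r - longRate a β σ) / a) 0)) := by
        refine setLIntegral_mono' measurableSet_Ici fun s hs => ?_
        rw [← ENNReal.ofReal_mul (Real.exp_pos _).le, ← Real.exp_add]
        exact ENNReal.ofReal_le_ofReal (Real.exp_le_exp.2 (logBondPrice_le ha hs))
    _ = _ := by
        rw [lintegral_mul_const' _ _ ENNReal.ofReal_ne_top, lintegral_Ici_exp_neg_mul hb,
          ← ENNReal.ofReal_mul (one_div_pos.2 hb).le, one_div_mul_eq_div]

variable {Ω : Type*} [MeasurableSpace Ω] {P : Measure Ω} {B ρ : ℝ≥0 → Ω → ℝ}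

theorem IsVasicekSolution.lintegral_exp_neg_integral_le (hρ : IsVasicekSolution P B a β σ r ρ)
    (hB : IsBrownianReal B P) (ha : a ≠ 0) {s : ℝ} (hs : 0 ≤ s) :
    ∫⁻ ω, ENNReal.ofReal (Real.exp (-∫ u in (0 : ℝ)..s, ρ u.toNNReal ω)) ∂P
      ≤ ENNReal.ofReal (Real.exp (logBondPrice a β σ r s)) := by
  let D : ℝ → ℝ := fun u => bondDuration a (s - u)
  let μ : ℝ := β * s + (r - β) * bondDuration a s
  have hD : ContDiff ℝ 1 D := (contDiff_bondDuration a).comp (contDiff_const.sub contDiff_id)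
  have hdecomp : ∀ᵐ ω ∂P, -∫ u in (0 : ℝ)..s, ρ u.toNNReal ω
      = -μ + -σ * stieltjesIntegral D (fun u => B u.toNNReal ω) s := by
    filter_upwards [hρ.ae_integral_eq hB ha, hB.eval_zero_ae_eq_zero] with ω hω hB0
    rw [hω s hs, stieltjesIntegral_bondDuration_const_sub ha, Real.toNNReal_zero, hB0]
    ring
  calc _ = ∫⁻ ω, ENNReal.ofReal (Real.exp (-μ)) * ENNReal.ofReal
        (Real.exp (-σ * stieltjesIntegral D (fun u => B u.toNNReal ω) s)) ∂P := by
        refine lintegral_congr_ae (hdecomp.mono fun ω hω => ?_)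
        simp only [hω, Real.exp_add, ENNReal.ofReal_mul (Real.exp_pos _).le]
    _ ≤ ENNReal.ofReal (Real.exp (-μ))
        * ENNReal.ofReal (Real.exp ((-σ) ^ 2 / 2 * ∫ u in (0 : ℝ)..s, D u ^ 2)) := by
        rw [lintegral_const_mul' _ _ ENNReal.ofReal_ne_top]
        gcongr
        exact lintegral_exp_mul_stieltjesIntegral_le hB hD hs (-σ)
    _ = _ := by
        rw [← ENNReal.ofReal_mul (Real.exp_pos _).le, ← Real.exp_add,
          integral_bondDuration_const_sub_sq ha]
        congr 2
        simp only [μ, logBondPrice, longRate]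
        field_simp
        ring

theorem IsVasicekSolution.lintegral_lintegral_exp_neg_integral_le
    (hρ : IsVasicekSolution P B a β σ r ρ) (hB : IsBrownianReal B P)
    (hBm : ∀ t, Measurable (B t)) (ha : 0 < a) (hb : 0 < longRate a β σ) :
    ∫⁻ ω, (∫⁻ s in Set.Ici (0 : ℝ),
        ENNReal.ofReal (Real.exp (-∫ u in (0 : ℝ)..s, ρ u.toNNReal ω))) ∂P
      ≤ ENNReal.ofReal (Real.exp (-min ((r - longRate a β σ) / a) 0) / longRate a β σ) := by
  have : IsProbabilityMeasure P := hB.isGaussianProcess.isProbabilityMeasure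
  obtain ⟨U, hU, hρU⟩ := hρ.exists_measurable_integral hB hBm ha.ne'
  calc _ = ∫⁻ ω, (∫⁻ s in Set.Ici (0 : ℝ), ENNReal.ofReal (Real.exp (-U (ω, s)))) ∂P :=
        lintegral_congr_ae <| hρU.mono fun ω hω =>
          setLIntegral_congr_fun measurableSet_Ici fun s hs => by simp only [hω s hs]
    _ = ∫⁻ s in Set.Ici (0 : ℝ), ∫⁻ ω, ENNReal.ofReal (Real.exp (-U (ω, s))) ∂P :=
        lintegral_lintegral_swap (by fun_prop)
    _ ≤ ∫⁻ s in Set.Ici (0 : ℝ), ENNReal.ofReal (Real.exp (logBondPrice a β σ r s)) := by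
        refine setLIntegral_mono' measurableSet_Ici fun s hs => ?_
        refine (lintegral_congr_ae (hρU.mono fun ω hω => ?_)).trans_le
          (hρ.lintegral_exp_neg_integral_le hB ha.ne' hs)
        simp only [hω s hs]
    _ ≤ _ := lintegral_Ici_exp_logBondPrice_le ha hb

theorem Model.returnFunction_le (m : Model Ω P) {l : ℝ≥0 → Ω → ℝ} {K : ℝ}
    (hl : ∀ t ω, l t ω ≤ K) (r x : ℝ) :
    m.returnFunction l r x ≤ ENNReal.ofReal K * ∫⁻ ω, (∫⁻ s in Set.Ici (0 : ℝ),
      ENNReal.ofReal (Real.exp (-m.integratedRate r s ω))) ∂P := by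
  rw [← lintegral_const_mul' _ _ ENNReal.ofReal_ne_top]
  refine lintegral_mono fun ω => ?_
  rw [← lintegral_const_mul' _ _ ENNReal.ofReal_ne_top]
  refine (lintegral_mono_set fun s hs => hs.1).trans (lintegral_mono fun s => ?_)
  rw [mul_comm (ENNReal.ofReal K), ← ENNReal.ofReal_mul (Real.exp_pos _).le]
  exact ENNReal.ofReal_le_ofReal (mul_le_mul_of_nonneg_left (hl _ _) (Real.exp_pos _).le)

end BondPrice

end VasicekDividend

theorem lemma1 {Ω : Type*} [MeasurableSpace Ω] (P : Measure Ω) [IsProbabilityMeasure P]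
    (m : VasicekDividend.Model Ω P) (b : ℝ)
    (hb : b = m.bhat - m.sigma ^ 2 / (2 * m.a ^ 2)) (hb_pos : 0 < b)
    (r x : ℝ) (hx : 0 ≤ x) :
    m.value r x ≤ ENNReal.ofReal (m.M * Real.exp (-min ((r - b) / m.a) 0) / b) := by
  subst hb
  refine iSup₂_le fun l hl => (m.returnFunction_le (fun t ω => (hl.mem_Icc t ω).2) r x).trans ?_
  rw [mul_div_assoc, ENNReal.ofReal_mul m.M_pos.le]
  gcongr
  exact (m.rate_sde r).lintegral_lintegral_exp_neg_integral_le m.brownian m.B_measurable m.a_pos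
    hb_pos
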